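/- Let $\Gamma$ be a countable group and let $\mathcal F(\Gamma)$ be the set of its nonempty finite subsets. For $K\in\mathcal F(\Gamma)$ and $\delta>0$ let $\mathcal B(K,\delta)$ be the set of all $F\in\mathcal F(\Gamma)$ with $|\{t\in F: Kt\subseteq F\}|\ge(1-\delta)|F|$. Assume that $\Gamma$ is amenable, i.e. that $\mathcal B(K,\delta)\neq\emptyset$ for all $K\in\mathcal F(\Gamma)$ and $\delta>0$. Write $\lim_F\varphi(F)=c$ if for every $\varepsilon>0$ there are $K\in\mathcal F(\Gamma)$ and $\delta>0$ such that $|\varphi(F)-c|<\varepsilon$ for all $F\in\mathcal B(K,\delta)$. Let $\Gamma$ act continuously on compact metrizable spaces $X$ and $Y$, and let $\pi\colon X\to Y$ be a factor map, i.e. a continuous $\Gamma$-equivariant surjection. For families $\mathcal A,\mathcal B$ of subsets of $X$ put $\mathcal A\vee\mathcal B=\{A\cap B: A\in\mathcal A,\ B\in\mathcal B\}$, and say that $\mathcal A$ refines $\mathcal B$ if every element of $\mathcal A$ is contained in an element of $\mathcal B$. For a finite open cover $\mathcal W$ of $X$ put $\mathrm{ord}(\mathcal W)=\max_{x\in X}|\{W\in\mathcal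 W: x\in W\}|-1$ (read as $0$ if $X=\emptyset$). For a finite open cover $\mathcal U$ of $X$ let $\mathcal D(\mathcal U|Y)$ be the minimum of $\mathrm{ord}(\mathcal W)$ over all finite open covers $\mathcal W$ of $X$ such that $\{\pi^{-1}(y)\}_{y\in Y}\vee\mathcal W$ refines $\mathcal U$, and for $F\in\mathcal F(\Gamma)$ let $\mathcal U^F=\bigvee_{s\in F}s^{-1}\mathcal U$. Define the conditional mean dimension $$\mathrm{mdim}(X|Y)=\sup_{\mathcal U}\lim_F\frac{\mathcal D(\mathcal U^F|Y)}{|F|}\in[0,\infty],$$ where $\mathcal U$ runs over all finite open covers of $X$, and let the mean dimension $\mathrm{mdim}(X)$ be the same quantity with $Y$ replaced by a one-point space; $\mathrm{mdim}(Y)$ is defined in the same way from the action on $Y$. Then the limits in the definitions of $\mathrm{mdim}(X)$, $\mathrm{mdim}(Y)$ and $\mathrm{mdim}(X|Y)$ exist and are finite for every finite open cover, and $$\mathrm{mdim}(X)\le\mathrm{mdim}(Y)+\mathrm{mdim}(X|Y).$$ -/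

import Mathlib

open Filter Topology
open scoped ENNReal

namespace CondMdim

section Amenable

/-- `ℬ(K, δ)`: the nonempty finite `F ⊆ Γ` with `|{t ∈ F : K t ⊆ F}| ≥ (1 - δ) |F|`. -/
def invariantSets {Γ : Type*} [Group Γ] (K : Finset Γ) (δ : ℝ) : Set (Finset Γ) :=
  {F | F.Nonempty ∧ (1 - δ) * (F.card : ℝ) ≤ ({t | t ∈ F ∧ ∀ k ∈ K, k * t ∈ F}.ncard : ℝ)}

/-- Amenability: every `ℬ(K, δ)` is nonempty. -/
def IsAmenable (Γ : Type*) [Group Γ] : Prop :=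
  ∀ K : Finset Γ, K.Nonempty → ∀ δ : ℝ, 0 < δ → (invariantSets K δ).Nonempty

/-- The filter "as `F` becomes more and more invariant", generated by the sets `ℬ(K, δ)`. -/
def invariantFilter (Γ : Type*) [Group Γ] : Filter (Finset Γ) :=
  ⨅ (K : Finset Γ) (_ : K.Nonempty) (δ : ℝ) (_ : 0 < δ), 𝓟 (invariantSets K δ)

end Amenable

section Covers

/-- Finite open covers of `X`, as families of subsets. -/
structure IsFinOpenCover {X : Type*} [TopologicalSpace X] (𝒰 : Set (Set X)) : Prop where
  finite : 𝒰.Finite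
  isOpen : ∀ U ∈ 𝒰, IsOpen U
  sUnion_eq : ⋃₀ 𝒰 = Set.univ

/-- `𝒜` refines `ℬ`: every element of `𝒜` is contained in some element of `ℬ`. -/
def Refines {X : Type*} (𝒜 ℬ : Set (Set X)) : Prop :=
  ∀ A ∈ 𝒜, ∃ B ∈ ℬ, A ⊆ B

/-- The joining `𝒜 ∨ ℬ = {A ∩ B : A ∈ 𝒜, B ∈ ℬ}`. -/
def join {X : Type*} (𝒜 ℬ : Set (Set X)) : Set (Set X) :=
  Set.image2 (fun A B => A ∩ B) 𝒜 ℬ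

/-- The family of fibers `{π⁻¹(y)}` for `y ∈ Y`. -/
def fibers {X Y : Type*} (π : X → Y) : Set (Set X) :=
  Set.range fun y => π ⁻¹' {y}

/-- `ord(𝒲) = max_x (number of elements of 𝒲 containing x) - 1`, for a finite family `𝒲`. The
maximum is at least `1` for a cover of a nonempty space; on the empty space the value is `0`. -/
noncomputable def ord {X : Type*} (𝒲 : Set (Set X)) : ℕ :=
  (⨆ x : X, {W | W ∈ 𝒲 ∧ x ∈ W}.ncard) - 1

/-- `𝒟(𝒰 | Y)`: the least `ord(𝒲)` over the finite open covers `𝒲` of `X` such that the joining of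
`𝒲` with the fibers of `π` refines `𝒰`. -/
noncomputable def condD {X Y : Type*} [TopologicalSpace X] (π : X → Y) (𝒰 : Set (Set X)) : ℕ :=
  sInf {n | ∃ 𝒲 : Set (Set X), IsFinOpenCover 𝒲 ∧ Refines (join (fibers π) 𝒲) 𝒰 ∧ ord 𝒲 = n}

/-- `𝒰^F`, the joining of the covers `s⁻¹𝒰` for `s ∈ F`: its elements are the intersections
of sets `s⁻¹ U_s` for `s ∈ F`, with all `U_s ∈ 𝒰`. -/
def coverPow {Γ X : Type*} [Group Γ] [MulAction Γ X] (𝒰 : Set (Set X)) (F : Finset Γ) :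
    Set (Set X) :=
  {A | ∃ U : Γ → Set X, (∀ s ∈ F, U s ∈ 𝒰) ∧ A = ⋂ s ∈ F, (fun x : X => s • x) ⁻¹' U s}

theorem IsFinOpenCover.coverPow {Γ X : Type*} [Group Γ] [TopologicalSpace X] [MulAction Γ X]
    [ContinuousConstSMul Γ X] {𝒰 : Set (Set X)} (h : IsFinOpenCover 𝒰) (F : Finset Γ) :
    IsFinOpenCover (CondMdim.coverPow 𝒰 F) := by
  refine ⟨?_, ?_, ?_⟩
  · have : Finite 𝒰 := h.finite
    refine (Set.finite_range fun V : F → 𝒰 =>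
      ⋂ s : F, (fun x : X => (s : Γ) • x) ⁻¹' (V s : Set X)).subset ?_
    rintro A ⟨U, hU, rfl⟩
    exact ⟨fun s => ⟨U s, hU s s.2⟩, by ext x; simp⟩
  · rintro A ⟨U, hU, rfl⟩
    exact isOpen_biInter_finset fun s hs =>
      (h.isOpen _ (hU s hs)).preimage (continuous_const_smul s)
  · refine Set.eq_univ_of_forall fun x => ?_
    have key : ∀ s : Γ, ∃ U ∈ 𝒰, s • x ∈ U := fun s =>
      Set.mem_sUnion.1 (h.sUnion_eq ▸ Set.mem_univ (s • x))
    choose U hU hx using key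
    exact ⟨_, ⟨U, fun s _ => hU s, rfl⟩, by simp [hx]⟩

/-- For a finite open cover `𝒰` the minimum defining `𝒟(𝒰 | Y)` is attained. -/
theorem exists_ord_eq_condD {X Y : Type*} [TopologicalSpace X] (π : X → Y) {𝒰 : Set (Set X)}
    (h : IsFinOpenCover 𝒰) :
    ∃ 𝒲 : Set (Set X), IsFinOpenCover 𝒲 ∧ Refines (join (fibers π) 𝒲) 𝒰 ∧
      ord 𝒲 = condD π 𝒰 := by
  refine Nat.sInf_mem
    (s := {n | ∃ 𝒲 : Set (Set X), IsFinOpenCover 𝒲 ∧ Refines (join (fibers π) 𝒲) 𝒰 ∧ ord 𝒲 = n})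
    ⟨ord 𝒰, 𝒰, h, ?_, rfl⟩
  rintro _ ⟨A, _, B, hB, rfl⟩
  exact ⟨B, hB, Set.inter_subset_right⟩

end Covers

section MeanDimension

/-- The quotient `𝒟(𝒰^F | Y) / |F|`. -/
noncomputable def condDAverage {Γ X Y : Type*} [Group Γ] [TopologicalSpace X] [MulAction Γ X]
    (π : X → Y) (𝒰 : Set (Set X)) (F : Finset Γ) : ℝ≥0∞ :=
  (condD π (coverPow 𝒰 F) : ℝ≥0∞) / (F.card : ℝ≥0∞)

/-- The upper limit of `𝒟(𝒰^F | Y) / |F|` as `F` becomes more and more invariant; it is the limit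
whenever `LimitsExist Γ π` holds. -/
noncomputable def coverMdim (Γ : Type*) {X Y : Type*} [Group Γ] [TopologicalSpace X]
    [MulAction Γ X] (π : X → Y) (𝒰 : Set (Set X)) : ℝ≥0∞ :=
  limsup (condDAverage (Γ := Γ) π 𝒰) (invariantFilter Γ)

/-- For every finite open cover `𝒰` of `X`, `𝒟(𝒰^F | Y) / |F|` converges (to a finite limit) as
`F` becomes more and more invariant, and `coverMdim Γ π 𝒰` is the limit. -/
def LimitsExist (Γ : Type*) {X Y : Type*} [Group Γ] [TopologicalSpace X] [MulAction Γ X]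
    (π : X → Y) : Prop :=
  ∀ 𝒰 : Set (Set X), IsFinOpenCover 𝒰 →
    coverMdim Γ π 𝒰 ≠ ∞ ∧
      Tendsto (condDAverage (Γ := Γ) π 𝒰) (invariantFilter Γ) (𝓝 (coverMdim Γ π 𝒰))

/-- The conditional mean dimension `mdim(X | Y)`. -/
noncomputable def condMdim (Γ : Type*) {X Y : Type*} [Group Γ] [TopologicalSpace X]
    [MulAction Γ X] (π : X → Y) : ℝ≥0∞ :=
  ⨆ (𝒰 : Set (Set X)) (_ : IsFinOpenCover 𝒰), coverMdim Γ π 𝒰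

/-- The map from `X` to the one-point space. -/
def toPoint (X : Type*) : X → Unit := fun _ => ()

/-- The mean dimension `mdim(X)`: the conditional mean dimension relative to a point. -/
noncomputable def mdim (Γ X : Type*) [Group Γ] [TopologicalSpace X] [MulAction Γ X] : ℝ≥0∞ :=
  condMdim Γ (toPoint X)

end MeanDimension

end CondMdim

/-! Interpolate between conditioning on a point and on the fibers by conditioning on covers
π⁻¹(𝒱^F), where 𝒱 is a finite open cover of Y. Since two finite open covers have a common refinement
whose order is at most the sum of their orders (`exists_common_refinement`), 𝒟(𝒰^F) is at most
𝒟(𝒱^F) plus the order needed to refine 𝒰^F along π⁻¹(𝒱^F) (`condD_toPoint_le_add`). After division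
by |F| the first term has limit at most mdim(Y). What remains is to find one 𝒱, independent of F,
for which the second term is nearly 𝒟(𝒰^F|Y).

For a single set T, compactness replaces the fibers by preimages of an open cover of Y without
raising the order (`exists_cover_of_fibers`), and one cover 𝒱₀ serves finitely many T
(`exists_coverPow_refines`). For fixed 𝒱₀ the second term is a subadditive, right-invariant function
of F, so Ornstein–Weiss quasi-tiling carries a bound on finitely many tiles to all sufficiently
invariant F (`exists_tiles`). The tiles there are chosen before the function; this allows 𝒱₀, and
hence the function, to depend on them.

The same quasi-tiling, with tiles whose quotient is close to the lower limit, shows that the limits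
exist. -/

namespace CondMdim

/-! ### Quasi-tilings and invariant subadditive set functions. -/

section OrnsteinWeiss

open scoped Pointwise Classical

variable {Γ : Type*} [Group Γ]

theorem mem_invariantSets_iff {K F : Finset Γ} {δ : ℝ} :
    F ∈ invariantSets K δ ↔
      F.Nonempty ∧ ((F.filter fun t => ¬ ∀ k ∈ K, k * t ∈ F).card : ℝ) ≤ δ * F.card := by
  have h1 : {t | t ∈ F ∧ ∀ k ∈ K, k * t ∈ F}.ncard
      = (F.filter fun t => ∀ k ∈ K, k * t ∈ F).card := by
    rw [← Set.ncard_coe_finset]; congr 1; ext t; simp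
  have h2 := Finset.card_filter_add_card_filter_not (s := F) (fun t => ∀ k ∈ K, k * t ∈ F)
  have h3 : ((F.filter fun t => ∀ k ∈ K, k * t ∈ F).card : ℝ)
      + (F.filter fun t => ¬ ∀ k ∈ K, k * t ∈ F).card = F.card := by exact_mod_cast h2
  simp only [invariantSets, Set.mem_ofPred_eq, h1]
  refine and_congr_right fun _ => ⟨fun h => by linarith, fun h => by linarith⟩

theorem invariantSets_anti {K K' : Finset Γ} {δ δ' : ℝ} (hK : K ⊆ K') (hδ : δ' ≤ δ) :
    invariantSets K' δ' ⊆ invariantSets K δ := by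
  intro F hF
  rw [mem_invariantSets_iff] at hF ⊢
  refine ⟨hF.1, le_trans ?_ (hF.2.trans (by gcongr))⟩
  gcongr

theorem hasBasis_invariantFilter (Γ : Type*) [Group Γ] :
    (invariantFilter Γ).HasBasis (fun p : Finset Γ × ℝ => p.1.Nonempty ∧ 0 < p.2)
      (fun p => invariantSets p.1 p.2) := by
  have h : invariantFilter Γ = ⨅ p ∈ {p : Finset Γ × ℝ | p.1.Nonempty ∧ 0 < p.2},
      𝓟 (invariantSets p.1 p.2) := by
    simp only [invariantFilter, Set.mem_ofPred_eq, iInf_prod, iInf_and]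
    refine iInf_congr fun K => ?_
    rw [iInf_comm]
  rw [h]
  refine hasBasis_biInf_principal ?_ ⟨({1}, 1), by simp⟩
  rintro ⟨K, δ⟩ ⟨hK, hδ⟩ ⟨K', δ'⟩ ⟨_, hδ'⟩
  exact ⟨(K ∪ K', min δ δ'), ⟨hK.mono Finset.subset_union_left, lt_min hδ hδ'⟩,
    invariantSets_anti Finset.subset_union_left (min_le_left _ _),
    invariantSets_anti Finset.subset_union_right (min_le_right _ _)⟩

theorem eventually_nonempty_invariantFilter (Γ : Type*) [Group Γ] :
    ∀ᶠ F in invariantFilter Γ, F.Nonempty :=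
  (hasBasis_invariantFilter Γ).eventually_iff.2 ⟨({1}, 1), by simp, fun _ hF => hF.1⟩

theorem IsAmenable.neBot (h : IsAmenable Γ) : (invariantFilter Γ).NeBot :=
  (hasBasis_invariantFilter Γ).neBot_iff.2 fun {p} hp => h p.1 hp.1 p.2 hp.2

/-- A maximal `ε`-disjoint family of right translates of `T` with centers in `S` covers at least
`ε |S|` points. -/
theorem exists_almost_disjoint_translates (T S : Finset Γ) (hT : T.Nonempty) {ε : ℝ}
    (hε1 : ε ≤ 1) :
    ∃ C ⊆ S, (1 - ε) * (T.card * C.card) ≤ ((T * C).card : ℝ) ∧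
      ε * S.card ≤ ((T * C).card : ℝ) := by
  -- Almost disjointness is encoded by cardinality: the translates of T by C cover at least (1 -
  -- ε)|T||C| points. Take C of maximal size.
  obtain ⟨C, hC, hmax⟩ := Finset.exists_max_image
    (S.powerset.filter fun C => (1 - ε) * (T.card * C.card) ≤ ((T * C).card : ℝ)) Finset.card
    ⟨∅, by simp⟩
  simp only [Finset.mem_filter, Finset.mem_powerset] at hC hmax
  refine ⟨C, hC.1, hC.2, ?_⟩
  have hTpos : (0 : ℝ) < T.card := by exact_mod_cast hT.card_pos
  have hcard : ∀ c : Γ, (T * {c}).card = T.card := fun c => Finset.card_mul_singleton T c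
  -- A center whose translate met T * C in fewer than ε|T| points could be added to C, against
  -- maximality.
  have key : ∀ c ∈ S, ε * T.card ≤ (((T * {c}) ∩ (T * C)).card : ℝ) := by
    intro c hc
    by_cases hcC : c ∈ C
    · have : T * {c} ⊆ T * C := Finset.mul_subset_mul_left (by simpa using hcC)
      rw [Finset.inter_eq_left.2 this, hcard]
      nlinarith
    · by_contra! hlt
      have hins : T * insert c C = (T * {c}) ∪ (T * C) := by
        rw [Finset.insert_eq, Finset.mul_union]
      have hu : (((T * {c}) ∪ (T * C)).card : ℝ) + ((T * {c}) ∩ (T * C)).card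
          = T.card + (T * C).card := by
        have := Finset.card_union_add_card_inter (T * {c}) (T * C)
        rw [hcard] at this
        exact_mod_cast this
      have := hmax (insert c C) ⟨Finset.insert_subset hc hC.1, by
        rw [hins, Finset.card_insert_of_notMem hcC]
        push_cast
        nlinarith [hC.2]⟩
      rw [Finset.card_insert_of_notMem hcC] at this
      omega
  -- Double counting: a point a lies in T * {c} only if a * c⁻¹ ∈ T, so in at most |T| of the
  -- translates.
  have hsum : ∑ c ∈ S, ((T * {c}) ∩ (T * C)).card ≤ (T * C).card * T.card := by
    have h1 : ∀ c ∈ S, ((T * {c}) ∩ (T * C)).card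
        = ∑ a ∈ T * C, if a ∈ T * {c} then 1 else 0 := by
      intro c _
      rw [← Finset.card_filter, Finset.inter_comm, Finset.filter_mem_eq_inter]
    rw [Finset.sum_congr rfl h1, Finset.sum_comm, ← smul_eq_mul]
    refine Finset.sum_le_card_nsmul _ _ _ fun a _ => ?_
    rw [← Finset.card_filter]
    refine Finset.card_le_card_of_injOn (fun c => a * c⁻¹) ?_ ?_
    · intro c hc
      obtain ⟨t, ht, c', hc', rfl⟩ := Finset.mem_mul.1 (Finset.mem_filter.1 hc).2
      rw [Finset.mem_singleton] at hc'
      simpa [hc'] using ht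
    · intro c _ c' _ h
      simpa using h
  have h2 : (S.card : ℝ) * (ε * T.card) ≤ (T * C).card * T.card := by
    calc (S.card : ℝ) * (ε * T.card) = ∑ c ∈ S, ε * (T.card : ℝ) := by simp
      _ ≤ ∑ c ∈ S, (((T * {c}) ∩ (T * C)).card : ℝ) := Finset.sum_le_sum key
      _ ≤ _ := by exact_mod_cast hsum
  nlinarith

/-- The outer `K`-boundary of a `(K, η)`-invariant set is small. -/
theorem card_mul_sdiff_le {K T : Finset Γ} {η : ℝ} (hT : T ∈ invariantSets K η) :
    (((K * T) \ T).card : ℝ) ≤ K.card * (η * T.card) := by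
  rw [mem_invariantSets_iff] at hT
  have hsub : (K * T) \ T ⊆ K * (T.filter fun t => ¬ ∀ k ∈ K, k * t ∈ T) := by
    intro x hx
    obtain ⟨hx, hxT⟩ := Finset.mem_sdiff.1 hx
    obtain ⟨k, hk, t, ht, rfl⟩ := Finset.mem_mul.1 hx
    exact Finset.mul_mem_mul hk (Finset.mem_filter.2 ⟨ht, fun h => hxT (h k hk)⟩)
  calc (((K * T) \ T).card : ℝ)
      ≤ K.card * (T.filter fun t => ¬ ∀ k ∈ K, k * t ∈ T).card := by
        exact_mod_cast (Finset.card_le_card hsub).trans Finset.card_mul_le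
    _ ≤ _ := by gcongr; exact hT.2

/-- Removing from `F` a union `T * C` of translates of a very invariant tile leaves few points
whose `K`-translates leave the remainder. -/
theorem card_filter_sdiff_le {K T C F : Finset Γ} {δ η : ℝ}
    (hF : F ∈ invariantSets K δ) (hT : T ∈ invariantSets K⁻¹ η) :
    (((F \ (T * C)).filter fun t => ¬ ∀ k ∈ K, k * t ∈ F \ (T * C)).card : ℝ) ≤
      δ * F.card + C.card * (K.card * (η * T.card)) := by
  have hb := card_mul_sdiff_le hT
  rw [mem_invariantSets_iff] at hF
  have hsub : ((F \ (T * C)).filter fun t => ¬ ∀ k ∈ K, k * t ∈ F \ (T * C)) ⊆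
      (F.filter fun t => ¬ ∀ k ∈ K, k * t ∈ F) ∪ ((K⁻¹ * T) \ T) * C := by
    intro t ht
    simp only [Finset.mem_filter, Finset.mem_sdiff, not_forall] at ht
    obtain ⟨⟨htF, htA⟩, k, hk, hkt⟩ := ht
    by_cases hkF : k * t ∈ F
    · have hA : k * t ∈ T * C := by
        by_contra hA
        exact hkt ⟨hkF, hA⟩
      obtain ⟨s, hs, c, hc, hsc⟩ := Finset.mem_mul.1 hA
      refine Finset.mem_union_right _ ?_
      have ht : t = k⁻¹ * s * c := by rw [mul_assoc, hsc]; group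
      rw [ht]
      refine Finset.mul_mem_mul (Finset.mem_sdiff.2
        ⟨Finset.mul_mem_mul (Finset.inv_mem_inv hk) hs, fun h => htA ?_⟩) hc
      rw [ht]
      exact Finset.mul_mem_mul h hc
    · exact Finset.mem_union_left _ (Finset.mem_filter.2 ⟨htF, fun h => hkF (h k hk)⟩)
  have hcard : (((K⁻¹ * T) \ T) * C).card ≤ ((K⁻¹ * T) \ T).card * C.card := Finset.card_mul_le
  have h1 : (((F \ (T * C)).filter fun t => ¬ ∀ k ∈ K, k * t ∈ F \ (T * C)).card : ℝ) ≤
      (F.filter fun t => ¬ ∀ k ∈ K, k * t ∈ F).card + ((K⁻¹ * T) \ T).card * C.card := by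
    exact_mod_cast (Finset.card_le_card hsub).trans
      ((Finset.card_union_le _ _).trans (by gcongr))
  rw [Finset.card_inv] at hb
  have h2 : (((K⁻¹ * T) \ T).card : ℝ) * C.card ≤ C.card * (K.card * (η * T.card)) := by
    rw [mul_comm]; gcongr
  linarith [hF.2]

/-- Subadditive set functions on the finite subsets of `Γ`, invariant under right translation and
bounded by `b` times the cardinality. -/
structure IsInvariantSubadditive (φ : Finset Γ → ℝ) (b : ℝ) : Prop where
  union_le : ∀ A B, φ (A ∪ B) ≤ φ A + φ B
  mul_singleton : ∀ A c, φ (A * {c}) = φ A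
  le_mul_card : ∀ A, φ A ≤ b * A.card

/-- Subadditivity is assumed for arbitrary unions, so overlaps between the translates do no harm. -/
theorem IsInvariantSubadditive.mul_le {φ : Finset Γ → ℝ} {b : ℝ}
    (h : IsInvariantSubadditive φ b) (T C : Finset Γ) : φ (T * C) ≤ C.card * φ T := by
  induction C using Finset.induction_on with
  | empty => simpa using h.le_mul_card ∅
  | insert c C hc ih =>
    rw [Finset.card_insert_of_notMem hc, Finset.insert_eq, Finset.mul_union]
    have h1 := h.union_le (T * {c}) (T * C)
    rw [h.mul_singleton] at h1
    push_cast
    linarith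

/-- Inductive form of the Ornstein–Weiss lemma: with `n` stages of tiling, the uncovered part has
proportion at most `max ε ((1 - ε / 2) ^ n)`. -/
theorem exists_tiles_aux {P : Finset Γ → Prop} (hP : ∃ᶠ F in invariantFilter Γ, P F) {ε : ℝ}
    (hε : 0 < ε) (hε1 : ε < 1) (n : ℕ) :
    ∃ 𝒯 : Finset (Finset Γ), (∀ T ∈ 𝒯, P T) ∧ ∃ K : Finset Γ, K.Nonempty ∧ ∃ δ : ℝ, 0 < δ ∧
      ∀ F ∈ invariantSets K δ, ∀ (φ : Finset Γ → ℝ) (a b : ℝ), 0 ≤ a → 0 ≤ b →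
        IsInvariantSubadditive φ b → (∀ T ∈ 𝒯, φ T ≤ a * T.card) →
          φ F ≤ a / (1 - ε) * F.card + b * max ε ((1 - ε / 2) ^ n) * F.card := by
  have h1ε : 0 < 1 - ε := by linarith
  induction n with
  | zero =>
    refine ⟨∅, by simp, {1}, by simp, 1, one_pos, fun F _ φ a b ha hb hφ _ => ?_⟩
    have h1 : b * (1 : ℝ) ≤ b * max ε ((1 - ε / 2) ^ 0) := by
      gcongr; simp
    have h2 : 0 ≤ a / (1 - ε) * F.card := by positivity
    have h3 : b * (1 : ℝ) * F.card ≤ b * max ε ((1 - ε / 2) ^ 0) * F.card := by gcongr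
    linarith [hφ.le_mul_card F]
  | succ n ih =>
    obtain ⟨𝒯, h𝒯, K, hK, δ, hδ, ih⟩ := ih
    have hKpos : (0 : ℝ) < K.card := by exact_mod_cast hK.card_pos
    -- With this η the boundaries of the translates of T contribute at most (δε/2)|F| bad points.
    -- The invariance of F contributes another (δε/2)|F|, and the sum is at most δ|R| once |R| >
    -- ε|F|.
    set η : ℝ := δ * ε * (1 - ε) / (2 * K.card) with hη
    have hηpos : 0 < η := by positivity
    obtain ⟨T, hPT, hT⟩ := (hP.and_eventually ((hasBasis_invariantFilter Γ).mem_of_mem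
      (i := (K⁻¹, η)) ⟨hK.inv, hηpos⟩)).exists
    -- The new tile is very invariant relative to the data of the earlier stages, and is placed
    -- first. The bound 1/2 leaves at least |F|/2 admissible centers, so its translates cover at
    -- least (ε/2)|F| points; hence the factor 1 - ε/2.
    refine ⟨insert T 𝒯, by simpa using ⟨hPT, h𝒯⟩, K ∪ T, hK.mono Finset.subset_union_left,
      min (δ * ε / 2) (1 / 2), by positivity, fun F hF φ a b ha hb hφ hφT => ?_⟩
    have hTne : T.Nonempty := hT.1
    have hTpos : (0 : ℝ) < T.card := by exact_mod_cast hTne.card_pos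
    have hFK : F ∈ invariantSets K (δ * ε / 2) :=
      invariantSets_anti Finset.subset_union_left (min_le_left _ _) hF
    have hFT : F ∈ invariantSets T (1 / 2) :=
      invariantSets_anti Finset.subset_union_right (min_le_right _ _) hF
    obtain ⟨C, hCS, hC1, hC2⟩ := exists_almost_disjoint_translates T
      (F.filter fun t => ∀ k ∈ T, k * t ∈ F) hTne hε1.le
    have hAF : T * C ⊆ F := by
      intro x hx
      obtain ⟨t, ht, c, hc, rfl⟩ := Finset.mem_mul.1 hx
      exact (Finset.mem_filter.1 (hCS hc)).2 t ht
    have hScard : (F.card : ℝ) / 2 ≤ (F.filter fun t => ∀ k ∈ T, k * t ∈ F).card := by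
      have h2 : ((F.filter fun t => ∀ k ∈ T, k * t ∈ F).card : ℝ)
          + (F.filter fun t => ¬ ∀ k ∈ T, k * t ∈ F).card = F.card := by
        exact_mod_cast Finset.card_filter_add_card_filter_not (s := F) _
      linarith [(mem_invariantSets_iff.1 hFT).2]
    have hRA : ((F \ (T * C)).card : ℝ) + (T * C).card = F.card := by
      exact_mod_cast Finset.card_sdiff_add_card_eq_card hAF
    set R := F \ (T * C) with hR
    have hφA : φ (T * C) ≤ a / (1 - ε) * (T * C).card := by
      calc φ (T * C) ≤ C.card * φ T := hφ.mul_le T C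
        _ ≤ C.card * (a * T.card) := by gcongr; exact hφT T (by simp)
        _ = a / (1 - ε) * ((1 - ε) * (T.card * C.card)) := by field_simp
        _ ≤ _ := by gcongr
    have hφF : φ F ≤ φ (T * C) + φ R := by
      have h := hφ.union_le (T * C) R
      rwa [hR, Finset.union_sdiff_of_subset hAF] at h
    have hq : 0 ≤ a / (1 - ε) := by positivity
    -- A small remainder is absorbed by the trivial bound b|R|; a large one is still (K,
    -- δ)-invariant, and the earlier tiles handle it.
    by_cases hsmall : (R.card : ℝ) ≤ ε * F.card
    · have h1 : φ R ≤ b * max ε ((1 - ε / 2) ^ (n + 1)) * F.card := by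
        calc φ R ≤ b * R.card := hφ.le_mul_card R
          _ ≤ b * (ε * F.card) := by gcongr
          _ ≤ b * (max ε ((1 - ε / 2) ^ (n + 1)) * F.card) := by gcongr; exact le_max_left _ _
          _ = _ := by ring
      have h2 : a / (1 - ε) * ((T * C).card : ℝ) ≤ a / (1 - ε) * F.card := by
        gcongr
      linarith
    · push Not at hsmall
      have hFpos : (0 : ℝ) < F.card := by exact_mod_cast hF.1.card_pos
      have hRpos : (0 : ℝ) < R.card := lt_trans (by positivity) hsmall
      have hRinv : R ∈ invariantSets K δ := by
        rw [mem_invariantSets_iff]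
        refine ⟨Finset.card_pos.1 (by exact_mod_cast hRpos), ?_⟩
        have hbad := card_filter_sdiff_le (C := C) hFK hT
        have hAle : ((T * C).card : ℝ) ≤ F.card := by linarith
        have h3 : (C.card : ℝ) * (K.card * (η * T.card))
            = δ * ε / 2 * ((1 - ε) * (T.card * C.card)) := by
          rw [hη]; field_simp
        have h4 : δ * ε / 2 * ((1 - ε) * (T.card * C.card)) ≤ δ * ε / 2 * F.card := by
          gcongr
          exact hC1.trans hAle
        have h5 : δ * (ε * F.card) ≤ δ * R.card := by gcongr
        linarith
      have h6 := ih R hRinv φ a b ha hb hφ fun T' hT' => hφT T' (Finset.mem_insert_of_mem hT')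
      have h7 : (R.card : ℝ) ≤ (1 - ε / 2) * F.card := by nlinarith
      have h8 : max ε ((1 - ε / 2) ^ n) * (R.card : ℝ)
          ≤ max ε ((1 - ε / 2) ^ (n + 1)) * F.card := by
        rcases le_total ((1 - ε / 2) ^ n) ε with h | h
        · rw [max_eq_left h]
          have : (R.card : ℝ) ≤ F.card := by nlinarith
          gcongr
          exact le_max_left _ _
        · rw [max_eq_right h]
          have h0 : 0 ≤ (1 - ε / 2) ^ n := hε.le.trans h
          calc (1 - ε / 2) ^ n * (R.card : ℝ) ≤ (1 - ε / 2) ^ n * ((1 - ε / 2) * F.card) := by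
                gcongr
            _ = (1 - ε / 2) ^ (n + 1) * F.card := by ring
            _ ≤ _ := by gcongr; exact le_max_right _ _
      have h9 : b * (max ε ((1 - ε / 2) ^ n) * (R.card : ℝ))
          ≤ b * (max ε ((1 - ε / 2) ^ (n + 1)) * F.card) := by gcongr
      have h10 : a / (1 - ε) * ((R.card : ℝ) + (T * C).card) = a / (1 - ε) * F.card := by rw [hRA]
      linarith

/-- The Ornstein–Weiss lemma: sufficiently invariant sets are quasi-tiled by finitely many tiles
taken from a class of sets that contains arbitrarily invariant ones. -/
theorem exists_tiles {P : Finset Γ → Prop} (hP : ∃ᶠ F in invariantFilter Γ, P F) {ε : ℝ}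
    (hε : 0 < ε) (hε1 : ε < 1) :
    ∃ 𝒯 : Finset (Finset Γ), (∀ T ∈ 𝒯, P T) ∧ ∀ᶠ F in invariantFilter Γ,
      ∀ (φ : Finset Γ → ℝ) (a b : ℝ), 0 ≤ a → 0 ≤ b →
        IsInvariantSubadditive φ b → (∀ T ∈ 𝒯, φ T ≤ a * T.card) →
          φ F ≤ (a / (1 - ε) + ε * b) * F.card := by
  obtain ⟨n, hn⟩ := exists_pow_lt_of_lt_one hε (show 1 - ε / 2 < 1 by linarith)
  obtain ⟨𝒯, h𝒯, K, hK, δ, hδ, h⟩ := exists_tiles_aux hP hε hε1 n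
  refine ⟨𝒯, h𝒯, (hasBasis_invariantFilter Γ).eventually_iff.2 ⟨(K, δ), ⟨hK, hδ⟩, ?_⟩⟩
  intro F hF φ a b ha hb hφ hT
  have := h F hF φ a b ha hb hφ hT
  rw [max_eq_left hn.le] at this
  linarith

end OrnsteinWeiss

/-! ### Orders of covers and common refinements. -/

section Order

variable {X : Type*}

theorem ord_le_iff {𝒲 : Set (Set X)} (h : 𝒲.Finite) {n : ℕ} :
    ord 𝒲 ≤ n ↔ ∀ x, {W | W ∈ 𝒲 ∧ x ∈ W}.ncard ≤ n + 1 := by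
  have hb : BddAbove (Set.range fun x : X => {W | W ∈ 𝒲 ∧ x ∈ W}.ncard) := by
    refine ⟨𝒲.ncard, ?_⟩
    rintro _ ⟨x, rfl⟩
    exact Set.ncard_le_ncard (fun W hW => hW.1) h
  rw [ord, Nat.sub_le_iff_le_add]
  refine ⟨fun hle x => (le_ciSup hb x).trans hle, fun hle => ?_⟩
  rcases isEmpty_or_nonempty X with hX | hX
  · simp
  · exact ciSup_le hle

theorem ncard_le_ord_add_one {𝒲 : Set (Set X)} (h : 𝒲.Finite) (x : X) :
    {W | W ∈ 𝒲 ∧ x ∈ W}.ncard ≤ ord 𝒲 + 1 :=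
  (ord_le_iff h).1 le_rfl x

/-- The order of an indexed family is controlled by the number of indices at each point. -/
theorem ord_range_le {ι : Type*} [Finite ι] {W : ι → Set X} {n : ℕ}
    (h : ∀ x, {i | x ∈ W i}.ncard ≤ n + 1) : ord (Set.range W) ≤ n := by
  refine (ord_le_iff (Set.finite_range W)).2 fun x => le_trans ?_ (h x)
  have : {V | V ∈ Set.range W ∧ x ∈ V} ⊆ W '' {i | x ∈ W i} := by
    rintro _ ⟨⟨i, rfl⟩, hx⟩
    exact ⟨i, hx, rfl⟩
  exact (Set.ncard_le_ncard this (Set.toFinite _)).trans (Set.ncard_image_le (Set.toFinite _))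

theorem isFinOpenCover_range [TopologicalSpace X] {ι : Type*} [Finite ι] {W : ι → Set X}
    (ho : ∀ i, IsOpen (W i)) (hc : ∀ x, ∃ i, x ∈ W i) : IsFinOpenCover (Set.range W) :=
  ⟨Set.finite_range W, by rintro _ ⟨i, rfl⟩; exact ho i,
    Set.eq_univ_of_forall fun x => by simpa using hc x⟩

theorem IsFinOpenCover.exists_mem [TopologicalSpace X] {𝒰 : Set (Set X)} (h : IsFinOpenCover 𝒰)
    (x : X) : ∃ U ∈ 𝒰, x ∈ U :=
  Set.mem_sUnion.1 (h.sUnion_eq ▸ Set.mem_univ x)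

/-- An injective enumeration of a finite open cover with a subordinate family of continuous
nonnegative functions summing to one. -/
theorem IsFinOpenCover.exists_partition [TopologicalSpace X] [NormalSpace X] {𝒲 : Set (Set X)}
    (h : IsFinOpenCover 𝒲) : ∃ (n : ℕ) (W : Fin n → Set X) (f : Fin n → X → ℝ),
      (∀ i, W i ∈ 𝒲) ∧ (∀ i, Continuous (f i)) ∧ (∀ i x, 0 ≤ f i x) ∧ (∀ x, ∑ i, f i x = 1) ∧
      (∀ i x, 0 < f i x → x ∈ W i) ∧
      (∀ x, (Finset.univ.filter fun i => 0 < f i x).card ≤ ord 𝒲 + 1) := by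
  have : Finite 𝒲 := h.finite
  obtain ⟨n, ⟨e⟩⟩ := Finite.exists_equiv_fin 𝒲
  set W : Fin n → Set X := fun i => (e.symm i : Set X) with hW
  have hinj : Function.Injective W := Subtype.val_injective.comp e.symm.injective
  obtain ⟨f, hf⟩ := PartitionOfUnity.exists_isSubordinate_of_locallyFinite (s := Set.univ)
    isClosed_univ W (fun i => h.isOpen _ (e.symm i).2) (locallyFinite_of_finite _) (by
      intro x _
      obtain ⟨U, hU, hx⟩ := h.exists_mem x
      exact Set.mem_iUnion.2 ⟨e ⟨U, hU⟩, by simpa [hW] using hx⟩)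
  have hmem : ∀ i x, 0 < f i x → x ∈ W i := fun i x hx => hf i (subset_tsupport _ hx.ne')
  refine ⟨n, W, fun i => f i, fun i => (e.symm i).2, fun i => (f i).continuous,
    fun i x => f.nonneg i x, fun x => ?_, hmem, fun x => ?_⟩
  · rw [← finsum_eq_sum_of_fintype]; exact f.sum_eq_one (Set.mem_univ x)
  · refine le_trans ?_ (ncard_le_ord_add_one h.finite x)
    rw [← Finset.card_image_of_injective _ hinj, ← Set.ncard_coe_finset]
    refine Set.ncard_le_ncard ?_ (h.finite.subset fun _ hV => hV.1)
    intro V hV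
    simp only [Finset.coe_image, Finset.coe_filter, Finset.mem_univ, true_and, Set.mem_image,
      Set.mem_ofPred_eq] at hV
    obtain ⟨i, hi, rfl⟩ := hV
    exact ⟨(e.symm i).2, hmem i x hi⟩

/-- The left end point of the `i`-th interval of the partition with lengths `u`. -/
def leftSum {n : ℕ} (u : Fin n → ℝ) (i : Fin n) : ℝ := ∑ k ∈ Finset.univ.filter (· < i), u k

theorem leftSum_add_le {n : ℕ} {u : Fin n → ℝ} (hu : ∀ i, 0 ≤ u i) {i i' : Fin n} (h : i < i') :
    leftSum u i + u i ≤ leftSum u i' := by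
  have : leftSum u i + u i = ∑ k ∈ insert i (Finset.univ.filter (· < i)), u k := by
    rw [Finset.sum_insert (by simp), leftSum, add_comm]
  rw [this]
  refine Finset.sum_le_sum_of_subset_of_nonneg ?_ fun k _ _ => hu k
  intro k hk
  simp only [Finset.mem_insert, Finset.mem_filter, Finset.mem_univ, true_and] at hk ⊢
  rcases hk with rfl | hk
  · exact h
  · exact hk.trans h

/-- Every point of `[0, ∑ u)` lies in an interval of the partition. -/
theorem exists_leftSum_le {n : ℕ} {u : Fin n → ℝ} {t : ℝ} (ht : 0 ≤ t) (h : t < ∑ i, u i) :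
    ∃ i, leftSum u i ≤ t ∧ t < leftSum u i + u i := by
  have hex : ∃ i, t < leftSum u i + u i := by
    rcases n with _ | n
    · simp at h; linarith
    · refine ⟨Fin.last n, ?_⟩
      convert h using 1
      have : leftSum u (Fin.last n) + u (Fin.last n)
          = ∑ k ∈ insert (Fin.last n) (Finset.univ.filter (· < Fin.last n)), u k := by
        rw [Finset.sum_insert (by simp), leftSum, add_comm]
      rw [this]
      congr 1
      ext k
      simpa using (Fin.le_last k).eq_or_lt
  classical
  -- Take the first interval ending after t; its left end is the right end of its predecessor, hence
  -- at most t.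
  obtain ⟨i, hi, hmin⟩ := WellFounded.has_min (wellFounded_lt (α := Fin n))
    {i | t < leftSum u i + u i} hex
  refine ⟨i, ?_, hi⟩
  by_contra! hlt
  rcases i with ⟨_ | k, hk⟩
  · have : leftSum u ⟨0, hk⟩ = 0 := by
      rw [leftSum, Finset.sum_eq_zero]
      intro k hk
      simp [Fin.lt_def] at hk
    linarith
  · have hk' : k < n := by omega
    refine hmin ⟨k, hk'⟩ ?_ (by simp [Fin.lt_def])
    have : leftSum u ⟨k + 1, hk⟩ = leftSum u ⟨k, hk'⟩ + u ⟨k, hk'⟩ := by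
      have h1 : (Finset.univ.filter (· < (⟨k + 1, hk⟩ : Fin n)))
          = insert ⟨k, hk'⟩ (Finset.univ.filter (· < (⟨k, hk'⟩ : Fin n))) := by
        ext l
        simp [Fin.lt_def, Fin.ext_iff]
        omega
      rw [leftSum, h1, Finset.sum_insert (by simp), leftSum, add_comm]
    simpa [this] using hlt

/-- Two interval partitions with `p` and `q` nondegenerate intervals have a common refinement into
at most `p + q - 1` nondegenerate intervals. -/
theorem card_overlaps_le {m n : ℕ} {u : Fin m → ℝ} {v : Fin n → ℝ} (hu : ∀ i, 0 ≤ u i)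
    (hv : ∀ j, 0 ≤ v j) {p q : ℕ}
    (hp : (Finset.univ.filter fun i => 0 < u i).card ≤ p + 1)
    (hq : (Finset.univ.filter fun j => 0 < v j).card ≤ q + 1) :
    {z : Fin m × Fin n | max (leftSum u z.1) (leftSum v z.2)
      < min (leftSum u z.1 + u z.1) (leftSum v z.2 + v z.2)}.ncard ≤ p + q + 1 := by
  set S : Set (Fin m × Fin n) := {z | max (leftSum u z.1) (leftSum v z.2)
      < min (leftSum u z.1 + u z.1) (leftSum v z.2 + v z.2)} with hS
  -- Overlapping pairs form a chain. Counting the nondegenerate intervals before each coordinate is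
  -- strictly increasing along it and takes values in {0, …, p + q}.
  set r : Fin m × Fin n → ℕ := fun z =>
    (Finset.univ.filter fun i => 0 < u i ∧ i < z.1).card
      + (Finset.univ.filter fun j => 0 < v j ∧ j < z.2).card with hr
  have hpos : ∀ z ∈ S, 0 < u z.1 ∧ 0 < v z.2 := by
    intro z hz
    simp only [hS, Set.mem_ofPred_eq, max_lt_iff, lt_min_iff] at hz
    constructor <;> linarith [hz.1.1, hz.2.2]
  have hstep : ∀ {k : ℕ} (w : Fin k → ℝ) {i i' : Fin k}, 0 < w i → i < i' →
      (Finset.univ.filter fun l => 0 < w l ∧ l < i).card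
        < (Finset.univ.filter fun l => 0 < w l ∧ l < i').card := by
    intro k w i i' hw hi
    refine Finset.card_lt_card (Finset.ssubset_iff_subset_ne.2 ⟨?_, fun h => ?_⟩)
    · intro l hl
      simp only [Finset.mem_filter, Finset.mem_univ, true_and] at hl ⊢
      exact ⟨hl.1, hl.2.trans hi⟩
    · have : i ∈ Finset.univ.filter fun l => 0 < w l ∧ l < i := by rw [h]; simp [hw, hi]
      simp at this
  have hbound : ∀ {k : ℕ} (w : Fin k → ℝ) {i : Fin k} {c : ℕ}, 0 < w i →
      (Finset.univ.filter fun l => 0 < w l).card ≤ c + 1 →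
      (Finset.univ.filter fun l => 0 < w l ∧ l < i).card ≤ c := by
    intro k w i c hw hc
    have : (Finset.univ.filter fun l => 0 < w l ∧ l < i).card
        < (Finset.univ.filter fun l => 0 < w l).card := by
      refine Finset.card_lt_card (Finset.ssubset_iff_subset_ne.2 ⟨?_, fun h => ?_⟩)
      · intro l hl
        simp only [Finset.mem_filter, Finset.mem_univ, true_and] at hl ⊢
        exact hl.1
      · have : i ∈ Finset.univ.filter fun l => 0 < w l ∧ l < i := by rw [h]; simp [hw]
        simp at this
    omega
  have hmono : ∀ z ∈ S, ∀ z' ∈ S, z.1 < z'.1 → r z < r z' := by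
    intro z hz z' hz' h
    have h1 := hstep u (hpos z hz).1 h
    have h2 : z.2 ≤ z'.2 := by
      -- If the first index increased while the second decreased, the two overlaps would have to lie
      -- in opposite orders on the line.
      by_contra! hlt
      have ha := leftSum_add_le hu h
      have hb := leftSum_add_le hv hlt
      simp only [hS, Set.mem_ofPred_eq, max_lt_iff, lt_min_iff] at hz hz'
      linarith [hz.2.1, hz'.1.2]
    have h3 : (Finset.univ.filter fun j => 0 < v j ∧ j < z.2).card
        ≤ (Finset.univ.filter fun j => 0 < v j ∧ j < z'.2).card := by
      rcases h2.eq_or_lt with h | h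
      · rw [h]
      · exact (hstep v (hpos z hz).2 h).le
    simp only [hr]
    omega
  have hinj : Set.InjOn r S := by
    intro z hz z' hz' h
    rcases lt_trichotomy z.1 z'.1 with h1 | h1 | h1
    · exact absurd h (hmono z hz z' hz' h1).ne
    · rcases lt_trichotomy z.2 z'.2 with h2 | h2 | h2
      · have := hstep v (hpos z hz).2 h2
        simp only [hr, h1] at h
        omega
      · exact Prod.ext h1 h2
      · have := hstep v (hpos z' hz').2 h2
        simp only [hr, h1] at h
        omega
    · exact absurd h (hmono z' hz' z hz h1).ne'
  have hmaps : ∀ z ∈ S, r z ∈ ((Finset.range (p + q + 1) : Finset ℕ) : Set ℕ) := by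
    intro z hz
    have h1 := hbound u (hpos z hz).1 hp
    have h2 := hbound v (hpos z hz).2 hq
    simp only [hr, Finset.coe_range, Set.mem_Iio]
    omega
  have := Set.ncard_le_ncard_of_injOn r hmaps hinj (Finset.finite_toSet _)
  rwa [Set.ncard_coe_finset, Finset.card_range] at this

/-- Two finite open covers have a common open refinement whose order is at most the sum of their
orders. -/
theorem exists_common_refinement [TopologicalSpace X] [NormalSpace X] {𝒰 𝒱 : Set (Set X)}
    (h𝒰 : IsFinOpenCover 𝒰) (h𝒱 : IsFinOpenCover 𝒱) :
    ∃ 𝒲 : Set (Set X), IsFinOpenCover 𝒲 ∧ Refines 𝒲 𝒰 ∧ Refines 𝒲 𝒱 ∧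
      ord 𝒲 ≤ ord 𝒰 + ord 𝒱 := by
  obtain ⟨m, U, f, hU, hfc, hf0, hf1, hfU, hfo⟩ := h𝒰.exists_partition
  obtain ⟨n, V, g, hV, hgc, hg0, hg1, hgV, hgo⟩ := h𝒱.exists_partition
  -- The two partitions of unity cut [0, 1) into intervals at each x. W z is the locus where
  -- interval z.1 of the first and interval z.2 of the second overlap nontrivially, an open
  -- condition.
  set W : Fin m × Fin n → Set X := fun z =>
    {x | max (leftSum (f · x) z.1) (leftSum (g · x) z.2)
      < min (leftSum (f · x) z.1 + f z.1 x) (leftSum (g · x) z.2 + g z.2 x)} with hW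
  have hcl : ∀ i, Continuous fun x => leftSum (f · x) i := fun i =>
    continuous_finsetSum _ fun k _ => hfc k
  have hcr : ∀ j, Continuous fun x => leftSum (g · x) j := fun j =>
    continuous_finsetSum _ fun k _ => hgc k
  refine ⟨Set.range W, isFinOpenCover_range ?_ ?_, ?_, ?_, ord_range_le fun x => ?_⟩
  · intro z
    exact isOpen_lt ((hcl _).max (hcr _)) (((hcl _).add (hfc _)).min ((hcr _).add (hgc _)))
  -- The intervals containing the parameter 0 overlap; any other parameter in [0, 1) would serve
  -- equally.
  · intro x
    obtain ⟨i, hi⟩ := exists_leftSum_le (u := (f · x)) le_rfl (by rw [hf1]; exact one_pos)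
    obtain ⟨j, hj⟩ := exists_leftSum_le (u := (g · x)) le_rfl (by rw [hg1]; exact one_pos)
    exact ⟨(i, j), (max_le hi.1 hj.1).trans_lt (lt_min hi.2 hj.2)⟩
  · rintro _ ⟨z, rfl⟩
    refine ⟨U z.1, hU _, fun x hx => hfU _ _ ?_⟩
    simp only [hW, Set.mem_ofPred_eq, max_lt_iff, lt_min_iff] at hx
    linarith [hx.1.1]
  · rintro _ ⟨z, rfl⟩
    refine ⟨V z.2, hV _, fun x hx => hgV _ _ ?_⟩
    simp only [hW, Set.mem_ofPred_eq, max_lt_iff, lt_min_iff] at hx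
    linarith [hx.2.2]
  · exact card_overlaps_le (hf0 · x) (hg0 · x) (hfo x) (hgo x)

end Order

/-! ### Order relative to a family of subsets, and passage from fibers to open covers of the base.
-/

section RelativeOrder

variable {X Y : Type*}

theorem Refines.trans {𝒜 ℬ 𝒞 : Set (Set X)} (h : Refines 𝒜 ℬ) (h' : Refines ℬ 𝒞) :
    Refines 𝒜 𝒞 := fun A hA => by
  obtain ⟨B, hB, hAB⟩ := h A hA
  obtain ⟨C, hC, hBC⟩ := h' B hB
  exact ⟨C, hC, hAB.trans hBC⟩

theorem join_refines_left (𝒜 ℬ : Set (Set X)) : Refines (join 𝒜 ℬ) 𝒜 := by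
  rintro _ ⟨A, hA, B, _, rfl⟩
  exact ⟨A, hA, Set.inter_subset_left⟩

theorem join_refines_right (𝒜 ℬ : Set (Set X)) : Refines (join 𝒜 ℬ) ℬ := by
  rintro _ ⟨A, _, B, hB, rfl⟩
  exact ⟨B, hB, Set.inter_subset_right⟩

theorem Refines.join {𝒜 𝒜' ℬ ℬ' : Set (Set X)} (h : Refines 𝒜 𝒜') (h' : Refines ℬ ℬ') :
    Refines (join 𝒜 ℬ) (join 𝒜' ℬ') := by
  rintro _ ⟨A, hA, B, hB, rfl⟩
  obtain ⟨A', hA', hAA'⟩ := h A hA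
  obtain ⟨B', hB', hBB'⟩ := h' B hB
  exact ⟨_, ⟨A', hA', B', hB', rfl⟩, Set.inter_subset_inter hAA' hBB'⟩

theorem Refines.image_preimage {𝒜 ℬ : Set (Set Y)} (h : Refines 𝒜 ℬ) (f : X → Y) :
    Refines (Set.preimage f '' 𝒜) (Set.preimage f '' ℬ) := by
  rintro _ ⟨A, hA, rfl⟩
  obtain ⟨B, hB, hAB⟩ := h A hA
  exact ⟨_, ⟨B, hB, rfl⟩, Set.preimage_mono hAB⟩

theorem IsFinOpenCover.ord_preimage_le [TopologicalSpace Y] {𝒱 : Set (Set Y)}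
    (h : IsFinOpenCover 𝒱) (f : X → Y) :
    ord (Set.preimage f '' 𝒱) ≤ ord 𝒱 := by
  refine (ord_le_iff (h.finite.image _)).2 fun x =>
    le_trans ?_ (ncard_le_ord_add_one h.finite (f x))
  have hfin : {V | V ∈ 𝒱 ∧ f x ∈ V}.Finite := h.finite.subset fun _ hV => hV.1
  have : {W | W ∈ Set.preimage f '' 𝒱 ∧ x ∈ W} ⊆ Set.preimage f '' {V | V ∈ 𝒱 ∧ f x ∈ V} := by
    rintro _ ⟨⟨V, hV, rfl⟩, hx⟩
    exact ⟨V, ⟨hV, hx⟩, rfl⟩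
  exact (Set.ncard_le_ncard this (hfin.image _)).trans (Set.ncard_image_le hfin)

variable [TopologicalSpace X] [TopologicalSpace Y]

theorem IsFinOpenCover.join {𝒰 𝒱 : Set (Set X)} (h𝒰 : IsFinOpenCover 𝒰)
    (h𝒱 : IsFinOpenCover 𝒱) : IsFinOpenCover (join 𝒰 𝒱) := by
  refine ⟨h𝒰.finite.image2 _ h𝒱.finite, ?_, Set.eq_univ_of_forall fun x => ?_⟩
  · rintro _ ⟨U, hU, V, hV, rfl⟩
    exact (h𝒰.isOpen U hU).inter (h𝒱.isOpen V hV)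
  · obtain ⟨U, hU, hxU⟩ := h𝒰.exists_mem x
    obtain ⟨V, hV, hxV⟩ := h𝒱.exists_mem x
    exact ⟨_, ⟨U, hU, V, hV, rfl⟩, hxU, hxV⟩

theorem IsFinOpenCover.preimage {𝒱 : Set (Set Y)} (h : IsFinOpenCover 𝒱) {f : X → Y}
    (hf : Continuous f) : IsFinOpenCover (Set.preimage f '' 𝒱) := by
  refine ⟨h.finite.image _, ?_, Set.eq_univ_of_forall fun x => ?_⟩
  · rintro _ ⟨V, hV, rfl⟩
    exact (h.isOpen V hV).preimage hf
  · obtain ⟨V, hV, hx⟩ := h.exists_mem (f x)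
    exact ⟨_, ⟨V, hV, rfl⟩, hx⟩

/-- The least order of a finite open cover whose joining with `𝒜` refines `𝒰`. -/
noncomputable def relD (𝒜 𝒰 : Set (Set X)) : ℕ :=
  sInf {n | ∃ 𝒲 : Set (Set X), IsFinOpenCover 𝒲 ∧ Refines (join 𝒜 𝒲) 𝒰 ∧ ord 𝒲 = n}

theorem relD_le {𝒜 𝒰 𝒲 : Set (Set X)} (h𝒲 : IsFinOpenCover 𝒲)
    (h : Refines (join 𝒜 𝒲) 𝒰) : relD 𝒜 𝒰 ≤ ord 𝒲 :=
  Nat.sInf_le ⟨𝒲, h𝒲, h, rfl⟩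

theorem exists_ord_eq_relD (𝒜 : Set (Set X)) {𝒰 : Set (Set X)} (h : IsFinOpenCover 𝒰) :
    ∃ 𝒲 : Set (Set X), IsFinOpenCover 𝒲 ∧ Refines (join 𝒜 𝒲) 𝒰 ∧ ord 𝒲 = relD 𝒜 𝒰 :=
  Nat.sInf_mem (s := {n | ∃ 𝒲 : Set (Set X), IsFinOpenCover 𝒲 ∧ Refines (join 𝒜 𝒲) 𝒰 ∧
    ord 𝒲 = n}) ⟨ord 𝒰, 𝒰, h, join_refines_right _ _, rfl⟩

theorem relD_le_ord (𝒜 : Set (Set X)) {𝒰 : Set (Set X)} (h : IsFinOpenCover 𝒰) :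
    relD 𝒜 𝒰 ≤ ord 𝒰 :=
  relD_le h (join_refines_right _ _)

/-- Take a common refinement of optimal covers for the two terms. Conditioning on a finer family
only weakens the refinement requirement, so 𝒞 can replace both 𝒜 and ℬ. -/
theorem relD_le_add [NormalSpace X] {𝒜 ℬ 𝒞 𝒰 𝒱 𝒵 : Set (Set X)} (h𝒰 : IsFinOpenCover 𝒰)
    (h𝒱 : IsFinOpenCover 𝒱) (h𝒜 : Refines 𝒞 𝒜) (hℬ : Refines 𝒞 ℬ)
    (h𝒵 : Refines (join 𝒰 𝒱) 𝒵) : relD 𝒞 𝒵 ≤ relD 𝒜 𝒰 + relD ℬ 𝒱 := by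
  obtain ⟨𝒲₁, hc₁, hr₁, ho₁⟩ := exists_ord_eq_relD 𝒜 h𝒰
  obtain ⟨𝒲₂, hc₂, hr₂, ho₂⟩ := exists_ord_eq_relD ℬ h𝒱
  obtain ⟨𝒲, hc, h₁, h₂, ho⟩ := exists_common_refinement hc₁ hc₂
  rw [← ho₁, ← ho₂]
  refine (relD_le hc fun A hA => ?_).trans ho
  obtain ⟨U, hU, hAU⟩ := ((h𝒜.join h₁).trans hr₁) A hA
  obtain ⟨V, hV, hAV⟩ := ((hℬ.join h₂).trans hr₂) A hA
  obtain ⟨Z, hZ, hUZ⟩ := h𝒵 _ ⟨U, hU, V, hV, rfl⟩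
  exact ⟨Z, hZ, (Set.subset_inter hAU hAV).trans hUZ⟩

/-- If a cover is refined along the fibers of `π`, then, after shrinking, it is refined along the
preimages of some open cover of the base. -/
theorem exists_cover_of_fibers [CompactSpace X] [T2Space X] [CompactSpace Y] [T2Space Y]
    {π : X → Y} (hπ : Continuous π) {𝒲 𝒰 : Set (Set X)} (h𝒲 : IsFinOpenCover 𝒲)
    (h𝒰 : IsFinOpenCover 𝒰) (h : Refines (join (fibers π) 𝒲) 𝒰) :
    ∃ (𝒱 : Set (Set Y)) (𝒲' : Set (Set X)), IsFinOpenCover 𝒱 ∧ IsFinOpenCover 𝒲' ∧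
      Refines (join (Set.preimage π '' 𝒱) 𝒲') 𝒰 ∧ ord 𝒲' ≤ ord 𝒲 := by
  have : Finite 𝒲 := h𝒲.finite
  -- Shrink each W to a v W whose closure is still inside W; the compactness of these closures is
  -- what the tube argument needs.
  obtain ⟨v, hv, hvo, hvc⟩ := exists_iUnion_eq_closure_subset (u := fun W : 𝒲 => (W : Set X))
    (fun W => h𝒲.isOpen _ W.2) (fun x => Set.toFinite _)
    (by rw [← Set.sUnion_eq_iUnion]; exact h𝒲.sUnion_eq)
  have hex : ∀ (y : Y) (W : 𝒲), ∃ U ∈ 𝒰, π ⁻¹' {y} ∩ W ⊆ U := fun y W =>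
    h _ ⟨_, ⟨y, rfl⟩, W, W.2, rfl⟩
  choose U hU hUsub using hex
  -- N y consists of the points over which every closure (v W) stays inside the set U y W chosen for
  -- the fiber over y. It is open, since a compact set has closed image.
  set N : Y → Set Y := fun y => ⋂ W : 𝒲, (π '' (closure (v W) \ U y W))ᶜ with hN
  have hNo : ∀ y, IsOpen (N y) := fun y => isOpen_iInter_of_finite fun W =>
    (((isClosed_closure.sdiff (h𝒰.isOpen _ (hU y W))).isCompact.image hπ).isClosed).isOpen_compl
  have hyN : ∀ y, y ∈ N y := by
    intro y
    refine Set.mem_iInter.2 fun W => ?_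
    rintro ⟨x, ⟨hx, hxU⟩, rfl⟩
    exact hxU (hUsub _ W ⟨rfl, hvc W hx⟩)
  obtain ⟨t, ht⟩ := CompactSpace.elim_nhds_subcover N fun y => (hNo y).mem_nhds (hyN y)
  refine ⟨N '' t, Set.range v, ⟨t.finite_toSet.image _, ?_, ?_⟩, isFinOpenCover_range hvo ?_, ?_,
    ord_range_le fun x => ?_⟩
  · rintro _ ⟨y, _, rfl⟩
    exact hNo y
  · rw [Set.sUnion_image]
    simpa using ht
  · intro x
    simpa using (hv ▸ Set.mem_univ x : x ∈ ⋃ i, v i)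
  · rintro _ ⟨_, ⟨_, ⟨y, _, rfl⟩, rfl⟩, _, ⟨W, rfl⟩, rfl⟩
    refine ⟨U y W, hU y W, fun x hx => ?_⟩
    by_contra hxU
    exact Set.mem_iInter.1 hx.1 W ⟨x, ⟨subset_closure hx.2, hxU⟩, rfl⟩
  · refine le_trans ?_ (ncard_le_ord_add_one h𝒲.finite x)
    rw [← Set.ncard_image_of_injective _ Subtype.val_injective]
    refine Set.ncard_le_ncard ?_ (h𝒲.finite.subset fun _ hV => hV.1)
    rintro _ ⟨W, hW, rfl⟩
    exact ⟨W.2, hvc W (subset_closure hW)⟩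

/-- Pull back an optimal cover of Y: its members lie over elements of 𝒱, which is just the
conditioning used by the second term. A common refinement of both optimal covers then refines 𝒰
outright. -/
theorem condD_toPoint_le_add [NormalSpace X] {π : X → Y} (hπ : Continuous π) {𝒰 : Set (Set X)}
    {𝒱 : Set (Set Y)} (h𝒰 : IsFinOpenCover 𝒰) (h𝒱 : IsFinOpenCover 𝒱) :
    condD (toPoint X) 𝒰 ≤ condD (toPoint Y) 𝒱 + relD (Set.preimage π '' 𝒱) 𝒰 := by
  obtain ⟨𝒲₁, hc₁, hr₁, ho₁⟩ := exists_ord_eq_condD (toPoint Y) h𝒱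
  obtain ⟨𝒲₂, hc₂, hr₂, ho₂⟩ := exists_ord_eq_relD (Set.preimage π '' 𝒱) h𝒰
  obtain ⟨𝒲, hc, h₁, h₂, ho⟩ := exists_common_refinement (hc₁.preimage hπ) hc₂
  rw [← ho₁, ← ho₂]
  refine (relD_le hc ?_).trans (ho.trans (Nat.add_le_add_right (hc₁.ord_preimage_le π) _))
  refine (join_refines_right _ _).trans fun W hW => ?_
  obtain ⟨_, ⟨W₁, hW₁, rfl⟩, hWW₁⟩ := h₁ W hW
  obtain ⟨W₂, hW₂, hWW₂⟩ := h₂ W hW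
  obtain ⟨V, hV, hV₁⟩ := hr₁ _ ⟨_, ⟨(), rfl⟩, W₁, hW₁, rfl⟩
  obtain ⟨U, hU, hU₂⟩ := hr₂ _ ⟨_, ⟨V, hV, rfl⟩, W₂, hW₂, rfl⟩
  exact ⟨U, hU, fun x hx => hU₂ ⟨hV₁ ⟨rfl, hWW₁ hx⟩, hWW₂ hx⟩⟩

end RelativeOrder

/-! ### Dynamical powers of covers and their subadditivity. -/

section Powers

open scoped Pointwise Classical

variable {Γ X Y : Type*} [Group Γ] [MulAction Γ X] [MulAction Γ Y]

theorem coverPow_refines_of_subset (𝒰 : Set (Set X)) {F F' : Finset Γ} (h : F ⊆ F') :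
    Refines (coverPow 𝒰 F') (coverPow 𝒰 F) := by
  rintro _ ⟨U, hU, rfl⟩
  exact ⟨_, ⟨U, fun s hs => hU s (h hs), rfl⟩, Set.biInter_subset_biInter_left h⟩

theorem join_coverPow_refines (𝒰 : Set (Set X)) (F F' : Finset Γ) :
    Refines (join (coverPow 𝒰 F) (coverPow 𝒰 F')) (coverPow 𝒰 (F ∪ F')) := by
  rintro _ ⟨_, ⟨U, hU, rfl⟩, _, ⟨U', hU', rfl⟩, rfl⟩
  refine ⟨_, ⟨fun s => if s ∈ F then U s else U' s, fun s hs => ?_, rfl⟩, ?_⟩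
  · by_cases h : s ∈ F
    · simpa [h] using hU s h
    · simpa [h] using hU' s ((Finset.mem_union.1 hs).resolve_left h)
  · rintro x ⟨hx, hx'⟩
    simp only [Set.mem_iInter, Set.mem_preimage] at hx hx' ⊢
    intro s hs
    by_cases h : s ∈ F
    · simpa [h] using hx s h
    · simpa [h] using hx' s ((Finset.mem_union.1 hs).resolve_left h)

theorem coverPow_mul_singleton (𝒰 : Set (Set X)) (F : Finset Γ) (c : Γ) :
    coverPow 𝒰 (F * {c}) = Set.preimage (fun x : X => c • x) '' coverPow 𝒰 F := by
  ext A
  constructor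
  · rintro ⟨U, hU, rfl⟩
    refine ⟨_, ⟨fun s => U (s * c),
      fun s hs => hU _ (Finset.mul_mem_mul hs (Finset.mem_singleton_self c)), rfl⟩, ?_⟩
    ext x
    simp only [Set.mem_preimage, Set.mem_iInter, Finset.mem_mul, Finset.mem_singleton]
    constructor
    · rintro h _ ⟨s, hs, _, rfl, rfl⟩
      simpa [mul_smul] using h s hs
    · intro h s hs
      simpa [mul_smul] using h (s * c) ⟨s, hs, c, rfl, rfl⟩
  · rintro ⟨_, ⟨U, hU, rfl⟩, rfl⟩
    refine ⟨fun s => U (s * c⁻¹), ?_, ?_⟩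
    · intro s hs
      obtain ⟨t, ht, c', hc', rfl⟩ := Finset.mem_mul.1 hs
      rw [Finset.mem_singleton] at hc'
      simpa [hc'] using hU t ht
    · ext x
      simp only [Set.mem_preimage, Set.mem_iInter, Finset.mem_mul, Finset.mem_singleton]
      constructor
      · rintro h _ ⟨s, hs, _, rfl, rfl⟩
        simpa [mul_smul] using h s hs
      · intro h s hs
        simpa [mul_smul] using h (s * c) ⟨s, hs, c, rfl, rfl⟩

/-- Families of subsets indexed by the finite subsets of `Γ`, finer for larger sets and compatible
with right translation. -/
structure IsEquivariantFamily (𝒜 : Finset Γ → Set (Set X)) : Prop where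
  refines_of_subset : ∀ {F F' : Finset Γ}, F ⊆ F' → Refines (𝒜 F') (𝒜 F)
  mul_singleton_refines : ∀ (F : Finset Γ) (c : Γ),
    Refines (𝒜 (F * {c})) (Set.preimage (fun x : X => c • x) '' 𝒜 F)

theorem isEquivariantFamily_fibers {π : X → Y} (hequiv : ∀ (s : Γ) (x : X), π (s • x) = s • π x) :
    IsEquivariantFamily fun _ : Finset Γ => fibers π where
  refines_of_subset _ A hA := ⟨A, hA, subset_rfl⟩
  mul_singleton_refines := by
    rintro _ c _ ⟨y, rfl⟩
    refine ⟨_, ⟨_, ⟨c • y, rfl⟩, rfl⟩, fun x hx => ?_⟩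
    simp only [Set.mem_preimage, Set.mem_singleton_iff] at hx ⊢
    rw [hequiv, hx]

theorem isEquivariantFamily_preimage_coverPow {π : X → Y}
    (hequiv : ∀ (s : Γ) (x : X), π (s • x) = s • π x) (𝒱 : Set (Set Y)) :
    IsEquivariantFamily fun F : Finset Γ => Set.preimage π '' coverPow 𝒱 F where
  refines_of_subset h := (coverPow_refines_of_subset 𝒱 h).image_preimage π
  mul_singleton_refines := by
    intro F c
    rw [coverPow_mul_singleton]
    rintro _ ⟨_, ⟨A, hA, rfl⟩, rfl⟩
    refine ⟨_, ⟨_, ⟨A, hA, rfl⟩, rfl⟩, fun x hx => ?_⟩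
    simpa [hequiv] using hx

/-- Makes `exists_tiles` applicable both to the fibers, where the function is 𝒟(𝒰^F|Y), and to the
preimages of the powers of a cover of Y. -/
theorem isInvariantSubadditive_relD [TopologicalSpace X] [NormalSpace X] [ContinuousConstSMul Γ X]
    {𝒜 : Finset Γ → Set (Set X)} (h𝒜 : IsEquivariantFamily 𝒜) {𝒰 : Set (Set X)}
    (h𝒰 : IsFinOpenCover 𝒰) :
    IsInvariantSubadditive (fun F => (relD (𝒜 F) (coverPow 𝒰 F) : ℝ))
      (ord (coverPow 𝒰 ({1} : Finset Γ))) := by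
  have hunion : ∀ F F' : Finset Γ, relD (𝒜 (F ∪ F')) (coverPow 𝒰 (F ∪ F'))
      ≤ relD (𝒜 F) (coverPow 𝒰 F) + relD (𝒜 F') (coverPow 𝒰 F') := fun F F' =>
    relD_le_add (h𝒰.coverPow F) (h𝒰.coverPow F')
      (h𝒜.refines_of_subset Finset.subset_union_left)
      (h𝒜.refines_of_subset Finset.subset_union_right) (join_coverPow_refines 𝒰 F F')
  have htrans : ∀ (F : Finset Γ) (c : Γ), relD (𝒜 (F * {c})) (coverPow 𝒰 (F * {c}))
      ≤ relD (𝒜 F) (coverPow 𝒰 F) := by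
    intro F c
    obtain ⟨𝒲, hc, hr, ho⟩ := exists_ord_eq_relD (𝒜 F) (h𝒰.coverPow F)
    rw [← ho]
    refine (relD_le (hc.preimage (continuous_const_smul c)) ?_).trans (hc.ord_preimage_le _)
    rw [coverPow_mul_singleton]
    rintro _ ⟨A, hA, _, ⟨W, hW, rfl⟩, rfl⟩
    obtain ⟨_, ⟨B, hB, rfl⟩, hAB⟩ := h𝒜.mul_singleton_refines F c A hA
    obtain ⟨U, hU, hBU⟩ := hr _ ⟨B, hB, W, hW, rfl⟩
    exact ⟨_, ⟨U, hU, rfl⟩, fun x hx => hBU ⟨hAB hx.1, hx.2⟩⟩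
  have hinv : ∀ (F : Finset Γ) (c : Γ), relD (𝒜 (F * {c})) (coverPow 𝒰 (F * {c}))
      = relD (𝒜 F) (coverPow 𝒰 F) := by
    intro F c
    refine le_antisymm (htrans F c) ?_
    have h := htrans (F * {c}) c⁻¹
    have hF : F * {c} * {c⁻¹} = F := by
      rw [mul_assoc, Finset.singleton_mul_singleton, mul_inv_cancel, Finset.singleton_one, mul_one]
    rwa [hF] at h
  refine ⟨fun F F' => by exact_mod_cast hunion F F', fun F c => by exact_mod_cast hinv F c,
    fun F => ?_⟩
  norm_cast
  induction F using Finset.induction_on with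
  | empty =>
    -- The empty power is the trivial cover, of order 0.
    have hcov : IsFinOpenCover ({Set.univ} : Set (Set X)) :=
      ⟨Set.finite_singleton _, by simp, by simp⟩
    have h1 : relD (𝒜 ∅) (coverPow 𝒰 (∅ : Finset Γ)) ≤ ord ({Set.univ} : Set (Set X)) := by
      refine relD_le hcov fun A _ => ⟨Set.univ, ⟨fun _ => Set.univ, by simp, by simp⟩,
        Set.subset_univ _⟩
    have h2 : ord ({Set.univ} : Set (Set X)) ≤ 0 :=
      (ord_le_iff hcov.finite).2 fun x =>
        (Set.ncard_le_ncard (fun W hW => hW.1) hcov.finite).trans (by simp)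
    simpa using h1.trans h2
  | insert c F hc ih =>
    rw [Finset.card_insert_of_notMem hc, Finset.insert_eq]
    have h1 : relD (𝒜 {c}) (coverPow 𝒰 {c}) ≤ ord (coverPow 𝒰 ({1} : Finset Γ)) := by
      have h := hinv {1} c
      rw [Finset.singleton_mul_singleton, one_mul] at h
      rw [h]
      exact relD_le_ord _ (h𝒰.coverPow _)
    calc _ ≤ _ := hunion {c} F
      _ ≤ _ := add_le_add h1 ih
      _ = _ := by ring

/-- Finitely many open covers `𝒱 T` are simultaneously refined by the powers `𝒱₀^T` of a single
one. -/
theorem exists_coverPow_refines [TopologicalSpace Y] [ContinuousConstSMul Γ Y]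
    (𝒯 : Finset (Finset Γ)) (h𝒯 : ∀ T ∈ 𝒯, T.Nonempty) (𝒱 : Finset Γ → Set (Set Y))
    (h𝒱 : ∀ T ∈ 𝒯, IsFinOpenCover (𝒱 T)) :
    ∃ 𝒱₀ : Set (Set Y), IsFinOpenCover 𝒱₀ ∧ ∀ T ∈ 𝒯, Refines (coverPow 𝒱₀ T) (𝒱 T) := by
  induction 𝒯 using Finset.induction_on with
  | empty =>
    exact ⟨{Set.univ}, ⟨Set.finite_singleton _, by simp, by simp⟩, by simp⟩
  | insert T 𝒯 _ ih =>
    obtain ⟨𝒱₁, hc, hr⟩ := ih (fun T hT => h𝒯 T (Finset.mem_insert_of_mem hT))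
      fun T hT => h𝒱 T (Finset.mem_insert_of_mem hT)
    obtain ⟨t, ht⟩ := h𝒯 T (Finset.mem_insert_self T 𝒯)
    have hpow : ∀ {𝒞 𝒞' : Set (Set Y)} (F : Finset Γ), Refines 𝒞 𝒞' →
        Refines (coverPow 𝒞 F) (coverPow 𝒞' F) := by
      rintro 𝒞 𝒞' F h _ ⟨U, hU, rfl⟩
      have : ∀ s, ∃ V, s ∈ F → V ∈ 𝒞' ∧ U s ⊆ V := by
        intro s
        by_cases hs : s ∈ F
        · obtain ⟨V, hV, hUV⟩ := h _ (hU s hs)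
          exact ⟨V, fun _ => ⟨hV, hUV⟩⟩
        · exact ⟨∅, fun h => absurd h hs⟩
      choose V hV using this
      exact ⟨_, ⟨V, fun s hs => (hV s hs).1, rfl⟩,
        Set.iInter₂_mono fun s hs => Set.preimage_mono (hV s hs).2⟩
    -- Translating 𝒱 T by one chosen t ∈ T suffices: the factor at t in the T-th power undoes the
    -- translation.
    refine ⟨join 𝒱₁ (Set.preimage (fun y : Y => t⁻¹ • y) '' 𝒱 T),
      hc.join ((h𝒱 T (Finset.mem_insert_self T 𝒯)).preimage (continuous_const_smul _)), ?_⟩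
    intro T' hT'
    rcases Finset.mem_insert.1 hT' with rfl | hT'
    · refine (hpow T' (join_refines_right _ _)).trans ?_
      rintro _ ⟨U, hU, rfl⟩
      obtain ⟨V, hV, hVU⟩ := hU t ht
      refine ⟨V, hV, fun y hy => ?_⟩
      have := Set.mem_iInter₂.1 hy t ht
      simpa [← hVU] using this
    · exact (hpow T' (join_refines_left _ _)).trans (hr T' hT')

end Powers

/-! ### Existence of the limits. -/

section Limits

theorem natCast_div_le_ofReal {d n : ℕ} (hn : 0 < n) {t : ℝ} (h : (d : ℝ) ≤ t * n) :
    (d : ℝ≥0∞) / n ≤ ENNReal.ofReal t := by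
  have hn' : (0 : ℝ) < n := by exact_mod_cast hn
  rw [← ENNReal.ofReal_natCast d, ← ENNReal.ofReal_natCast n, ← ENNReal.ofReal_div_of_pos hn']
  exact ENNReal.ofReal_le_ofReal ((div_le_iff₀ hn').2 h)

theorem natCast_le_of_div_lt_ofReal {d n : ℕ} (hn : 0 < n) {t : ℝ}
    (h : (d : ℝ≥0∞) / n < ENNReal.ofReal t) : (d : ℝ) ≤ t * n := by
  have hn' : (0 : ℝ) < n := by exact_mod_cast hn
  rw [← ENNReal.ofReal_natCast d, ← ENNReal.ofReal_natCast n,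
    ← ENNReal.ofReal_div_of_pos hn'] at h
  exact ((div_lt_iff₀ hn').1 (ENNReal.ofReal_lt_ofReal_iff'.1 h).1).le

theorem le_add_ofReal_of_forall {L M : ℝ≥0∞} {c b : ℝ} (h : ∀ ε : ℝ, 0 < ε → ε < 1 →
    L ≤ M + ENNReal.ofReal ((c + ε) / (1 - ε) + ε * b)) : L ≤ M + ENNReal.ofReal c := by
  have hcont : Tendsto (fun ε : ℝ => (c + ε) / (1 - ε) + ε * b) (𝓝[>] 0) (𝓝 c) := by
    have : ContinuousAt (fun ε : ℝ => (c + ε) / (1 - ε) + ε * b) 0 := by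
      refine ContinuousAt.add (ContinuousAt.div ?_ ?_ (by norm_num)) ?_ <;> fun_prop
    simpa using this.tendsto.mono_left nhdsWithin_le_nhds
  refine ge_of_tendsto ((ENNReal.tendsto_ofReal hcont).const_add M) ?_
  filter_upwards [Ioo_mem_nhdsGT (zero_lt_one' ℝ)] with ε hε
  exact h ε hε.1 hε.2

variable {Γ X Y : Type*} [Group Γ] [TopologicalSpace X] [NormalSpace X]
  [MulAction Γ X] [ContinuousConstSMul Γ X] [MulAction Γ Y]

theorem limitsExist_of_equivariant (hΓ : IsAmenable Γ) {π : X → Y}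
    (hequiv : ∀ (s : Γ) (x : X), π (s • x) = s • π x) : LimitsExist Γ π := by
  intro 𝒰 h𝒰
  have := hΓ.neBot
  set b : ℝ := (ord (coverPow 𝒰 ({1} : Finset Γ)) : ℝ) with hb
  have hφ := isInvariantSubadditive_relD (isEquivariantFamily_fibers hequiv) h𝒰
  have hfin : coverMdim Γ π 𝒰 ≠ ∞ := by
    refine ne_top_of_le_ne_top (ENNReal.ofReal_ne_top (r := b))
      (limsup_le_of_le (by isBoundedDefault) ?_)
    filter_upwards [eventually_nonempty_invariantFilter Γ] with F hF
    exact natCast_div_le_ofReal hF.card_pos (hφ.le_mul_card F)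
  refine ⟨hfin, tendsto_of_le_liminf_of_limsup_le ?_ le_rfl⟩
  set c := liminf (condDAverage (Γ := Γ) π 𝒰) (invariantFilter Γ) with hc
  have hcfin : c ≠ ∞ := ne_top_of_le_ne_top hfin liminf_le_limsup
  suffices h : coverMdim Γ π 𝒰 ≤ 0 + ENNReal.ofReal c.toReal by
    rwa [zero_add, ENNReal.ofReal_toReal hcfin] at h
  refine le_add_ofReal_of_forall (b := b) fun ε hε hε1 => ?_
  have hlt : c < ENNReal.ofReal (c.toReal + ε) := by
    conv_lhs => rw [← ENNReal.ofReal_toReal hcfin]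
    exact (ENNReal.ofReal_lt_ofReal_iff (by positivity)).2 (by linarith)
  -- Sets with quotient below the lower limit plus ε occur arbitrarily far along the filter, so they
  -- can be the tiles; the upper limit then exceeds the lower one by an amount vanishing with ε.
  have hfreq := (frequently_lt_of_liminf_lt (by isBoundedDefault) hlt).and_eventually
    (eventually_nonempty_invariantFilter Γ)
  obtain ⟨𝒯, h𝒯, hev⟩ := exists_tiles hfreq hε hε1
  rw [zero_add]
  refine limsup_le_of_le (by isBoundedDefault) ?_
  filter_upwards [hev, eventually_nonempty_invariantFilter Γ] with F hF hne
  exact natCast_div_le_ofReal hne.card_pos (hF _ (c.toReal + ε) b (by positivity) (by positivity)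
    hφ fun T hT => natCast_le_of_div_lt_ofReal (h𝒯 T hT).2.card_pos (h𝒯 T hT).1)

theorem limitsExist_toPoint (hΓ : IsAmenable Γ) : LimitsExist Γ (toPoint X) := by
  -- The trivial action makes the map to the point equivariant.
  let _ : MulAction Γ Unit :=
    { smul := fun _ u => u, one_smul := fun _ => rfl, mul_smul := fun _ _ _ => rfl }
  exact limitsExist_of_equivariant hΓ fun _ _ => rfl

end Limits

/-! ### The addition inequality. -/

section Main

variable {Γ X Y : Type*} [Group Γ]
  [TopologicalSpace X] [CompactSpace X] [T2Space X] [MulAction Γ X] [ContinuousConstSMul Γ X]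
  [TopologicalSpace Y] [CompactSpace Y] [T2Space Y] [MulAction Γ Y] [ContinuousConstSMul Γ Y]

theorem mdim_le_add (hΓ : IsAmenable Γ) {π : X → Y} (hπ : Continuous π)
    (hequiv : ∀ (s : Γ) (x : X), π (s • x) = s • π x) :
    mdim Γ X ≤ mdim Γ Y + condMdim Γ π := by
  have := hΓ.neBot
  refine iSup₂_le fun 𝒰 h𝒰 => ?_
  obtain ⟨hfin, hlim⟩ := limitsExist_of_equivariant hΓ hequiv 𝒰 h𝒰
  set a := coverMdim Γ π 𝒰 with ha
  set b : ℝ := (ord (coverPow 𝒰 ({1} : Finset Γ)) : ℝ) with hb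
  suffices h : coverMdim Γ (toPoint X) 𝒰 ≤ mdim Γ Y + ENNReal.ofReal a.toReal by
    rw [ENNReal.ofReal_toReal hfin] at h
    exact h.trans (add_le_add_right (le_iSup₂ (f := fun 𝒰 (_ : IsFinOpenCover 𝒰) =>
      coverMdim Γ π 𝒰) 𝒰 h𝒰) _)
  refine le_add_ofReal_of_forall (b := b) fun ε hε hε1 => ?_
  have hlt : a < ENNReal.ofReal (a.toReal + ε) := by
    conv_lhs => rw [← ENNReal.ofReal_toReal hfin]
    exact (ENNReal.ofReal_lt_ofReal_iff (by positivity)).2 (by linarith)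
  obtain ⟨𝒯, h𝒯, hev⟩ := exists_tiles ((hlim.eventually_lt_const hlt).and
    (eventually_nonempty_invariantFilter Γ)).frequently hε hε1
  have hex : ∀ T : Finset Γ, ∃ (𝒱 : Set (Set Y)) (𝒲 : Set (Set X)), IsFinOpenCover 𝒱 ∧
      IsFinOpenCover 𝒲 ∧ Refines (join (Set.preimage π '' 𝒱) 𝒲) (coverPow 𝒰 T) ∧
      ord 𝒲 ≤ condD π (coverPow 𝒰 T) := by
    intro T
    obtain ⟨𝒲, hc, hr, ho⟩ := exists_ord_eq_condD π (h𝒰.coverPow T)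
    rw [← ho]
    exact exists_cover_of_fibers hπ hc (h𝒰.coverPow T) hr
  choose 𝒱 𝒲 h𝒱 h𝒲 hr ho using hex
  -- The tiles are fixed by now, so 𝒱₀ may depend on them; `hev` holds for every subadditive
  -- function, in particular for the one built from 𝒱₀.
  obtain ⟨𝒱₀, h𝒱₀, hpow⟩ := exists_coverPow_refines 𝒯 (fun T hT => (h𝒯 T hT).2) 𝒱
    fun T _ => h𝒱 T
  have hφ := isInvariantSubadditive_relD (isEquivariantFamily_preimage_coverPow hequiv 𝒱₀) h𝒰
  have hbound : ∀ᶠ F in invariantFilter Γ, condDAverage (Γ := Γ) (toPoint X) 𝒰 F ≤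
      condDAverage (Γ := Γ) (toPoint Y) 𝒱₀ F
        + ENNReal.ofReal ((a.toReal + ε) / (1 - ε) + ε * b) := by
    filter_upwards [hev, eventually_nonempty_invariantFilter Γ] with F hF hne
    have h1 := hF _ (a.toReal + ε) b (by positivity) (by positivity) hφ fun T hT => by
      refine le_trans ?_ (natCast_le_of_div_lt_ofReal (h𝒯 T hT).2.card_pos (h𝒯 T hT).1)
      exact_mod_cast (relD_le (h𝒲 T) ((((hpow T hT).image_preimage π).join
        fun W hW => ⟨W, hW, subset_rfl⟩).trans (hr T))).trans (ho T)
    have h2 : (condD (toPoint X) (coverPow 𝒰 F) : ℝ≥0∞) ≤ condD (toPoint Y) (coverPow 𝒱₀ F)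
        + relD (Set.preimage π '' coverPow 𝒱₀ F) (coverPow 𝒰 F) := by
      exact_mod_cast condD_toPoint_le_add hπ (h𝒰.coverPow F) (h𝒱₀.coverPow F)
    refine (ENNReal.div_le_div_right h2 _).trans ?_
    rw [ENNReal.add_div]
    exact add_le_add_right (natCast_div_le_ofReal hne.card_pos h1) _
  -- Convergence for 𝒱₀ evaluates the upper limit after the constant is added.
  have hY := (limitsExist_toPoint hΓ 𝒱₀ h𝒱₀).2
  calc coverMdim Γ (toPoint X) 𝒰 ≤ limsup (fun F => condDAverage (Γ := Γ) (toPoint Y) 𝒱₀ F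
        + ENNReal.ofReal ((a.toReal + ε) / (1 - ε) + ε * b)) (invariantFilter Γ) :=
        limsup_le_limsup hbound
    _ = coverMdim Γ (toPoint Y) 𝒱₀ + ENNReal.ofReal ((a.toReal + ε) / (1 - ε) + ε * b) :=
        (hY.add_const _).limsup_eq
    _ ≤ _ := add_le_add_left (le_iSup₂ (f := fun 𝒱 (_ : IsFinOpenCover 𝒱) =>
      coverMdim Γ (toPoint Y) 𝒱) 𝒱₀ h𝒱₀) _

end Main

end CondMdim

theorem theorem1p2 {Γ : Type*} [Group Γ] [Countable Γ] (hΓ : CondMdim.IsAmenable Γ)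
    {X Y : Type*}
    [TopologicalSpace X] [CompactSpace X] [TopologicalSpace.MetrizableSpace X]
    [MulAction Γ X] [ContinuousConstSMul Γ X]
    [TopologicalSpace Y] [CompactSpace Y] [TopologicalSpace.MetrizableSpace Y]
    [MulAction Γ Y] [ContinuousConstSMul Γ Y]
    (π : X → Y) (hπ : Continuous π) (hsurj : Function.Surjective π)
    (hequiv : ∀ (s : Γ) (x : X), π (s • x) = s • π x) :
    -- the limits that enter the three mean dimensions exist
    (CondMdim.LimitsExist Γ (CondMdim.toPoint X) ∧ CondMdim.LimitsExist Γ (CondMdim.toPoint Y) ∧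
      CondMdim.LimitsExist Γ π) ∧
    CondMdim.mdim Γ X ≤ CondMdim.mdim Γ Y + CondMdim.condMdim Γ π := by
  exact ⟨⟨CondMdim.limitsExist_toPoint hΓ, CondMdim.limitsExist_toPoint hΓ,
    CondMdim.limitsExist_of_equivariant hΓ hequiv⟩, CondMdim.mdim_le_add hΓ hπ hequiv⟩
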